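/- A topological graph $E=(E^0,E^1,r,s)$ consists of second countable locally compact Hausdorff spaces $E^0,E^1$, a continuous map $r:E^1\to E^0$ and a local homeomorphism $s:E^1\to E^0$. A vertex $v\in E^0$ is regular if it has an open neighbourhood $N$ with $r^{-1}(\overline N)$ compact and $v\notin\overline{E^0\setminus\overline{r(E^1)}}$; otherwise it is singular. For $n\ge 1$ let $$E^n=\{(\mu_1,\dots,\mu_n)\in (E^1)^n : s(\mu_i)=r(\mu_{i+1}),\ 1\le i<n\},\qquad E^\infty=\{(x_i)_{i\ge1}\in (E^1)^{\mathbb N_+} : s(x_i)=r(x_{i+1}),\ i\ge 1\},$$ with the subspace topologies of the product topologies. For $\mu\in E^n$ put $r(\mu)=r(\mu_1)$ and $s(\mu)=s(\mu_n)$; $\mu$ is a cycle with base point $r(\mu)$ if $r(\mu)=s(\mu)$, and a cycle $\mu$ has an entrance if there are $i$ and an edge $e\ne\mu_i$ with $r(e)=r(\mu_i)$. For $N\subseteq E^n$ and $k\ge1$ let $kN\subseteq E^{kn}$ be the set of paths that are concatenations of $k$ elements of $N$. Let $B^n$ be the set of all cycles $\mu\in E^n$ for which there exist $k\ge 1$ and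 an open neighbourhood $N$ of $\mu$ in $E^n$ such that (1) for any distinct $\alpha,\beta\in kN$ there is no $\gamma\in N$ with $r(\gamma)=s(\alpha)$ and $s(\gamma)=s(\beta)$; and (2) for any $\alpha\in kN$ there is no cycle in $N$ that has an entrance and has base point $s(\alpha)$. Let $\sigma:E^\infty\to E^\infty$, $x_1x_2x_3\cdots\mapsto x_2x_3\cdots$, be the shift. The boundary path groupoid is $$\Gamma(E^\infty,\sigma)=\{(x,k-\ell,y)\in E^\infty\times\mathbb Z\times E^\infty : k,\ell\ge 0,\ \sigma^k(x)=\sigma^\ell(y)\},$$ where $(x,m,y)$ has range $x$ and source $y$; its topology is generated by the sets $\{(x,k-\ell,y): x\in U,\ y\in W,\ \sigma^k(x)=\sigma^\ell(y)\}$ with $k,\ell\ge 0$ and $U,W\subseteq E^\infty$ open such that $\sigma^k$ is injective on $U$ and $\sigma^\ell$ is injective on $W$. Its isotropy group bundle is the set $\mathrm{Iso}(\Gamma(E^\infty,\sigma))$ of all its elements of the form $(x,m,x)$. **Theorem.** Let $E$ be a topological graph with no singular vertices. Then the interior of $\mathrm{Iso}(\Gamma(E^\infty,\sigma))$ in $\Gamma(E^\infty,\sigma)$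 is closed in $\Gamma(E^\infty,\sigma)$ if and only if $B^n$ is closed in $E^n$ for every $n\ge1$. -/

import Mathlib

open Set Topology

/-- A topological graph `(E⁰, E¹, r, s)`, with `V = E⁰` and `Ed = E¹`: both spaces are locally
compact Hausdorff, `r` is continuous and `s` is a local homeomorphism. -/
structure TopologicalGraph (V Ed : Type*)
    [TopologicalSpace V] [LocallyCompactSpace V] [T2Space V]
    [TopologicalSpace Ed] [LocallyCompactSpace Ed] [T2Space Ed] where
  /-- the range map -/
  r : Ed → V
  /-- the source map -/
  s : Ed → V
  continuous_r : Continuous r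
  isLocalHomeomorph_s : IsLocalHomeomorph s

namespace TopologicalGraph

variable {V Ed : Type*}
  [TopologicalSpace V] [LocallyCompactSpace V] [T2Space V]
  [TopologicalSpace Ed] [LocallyCompactSpace Ed] [T2Space Ed]
  (E : TopologicalGraph V Ed)

/-! ### Singular vertices -/

/-- The finite receivers: vertices with an open neighbourhood `N` such that `r⁻¹(closure N)` is
compact. -/
def finiteReceivers : Set V :=
  {v | ∃ N : Set V, IsOpen N ∧ v ∈ N ∧ IsCompact (E.r ⁻¹' closure N)}

/-- The sources: the complement of the closure of the image of `r`. -/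
def sources : Set V := (closure (range E.r))ᶜ

/-- The regular vertices. -/
def regularVertices : Set V := E.finiteReceivers \ closure E.sources

/-- The singular vertices. -/
def singularVertices : Set V := E.regularVerticesᶜ

/-! ### Finite and infinite paths -/

/-- `Eⁿ`: the sequences `μ₁ ⋯ μₙ` of edges (indexed here by `0, …, n - 1`) such that
`s(μᵢ) = r(μᵢ₊₁)`. It is used for `n ≥ 1` only. It carries the subspace topology of the product
topology. -/
abbrev Path (n : ℕ) : Type _ :=
  {μ : Fin n → Ed // ∀ (i : ℕ) (hi : i + 1 < n),
    E.s (μ ⟨i, Nat.lt_of_succ_lt hi⟩) = E.r (μ ⟨i + 1, hi⟩)}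

/-- `E^∞`: the infinite sequences of edges such that `s(xᵢ) = r(xᵢ₊₁)`, with the subspace topology
of the product topology. -/
abbrev InfPath : Type _ :=
  {x : ℕ → Ed // ∀ i : ℕ, E.s (x i) = E.r (x (i + 1))}

variable {E}

/-- The range `r(μ) = r(μ₁)` of a finite path of positive length. -/
def Path.range {n : ℕ} (hn : 1 ≤ n) (μ : E.Path n) : V := E.r (μ.1 ⟨0, hn⟩)

/-- The source `s(μ) = s(μₙ)` of a finite path of positive length. -/
def Path.source {n : ℕ} (hn : 1 ≤ n) (μ : E.Path n) : V :=
  E.s (μ.1 ⟨n - 1, Nat.sub_lt hn Nat.one_pos⟩)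

/-- A path is a cycle if its range and its source coincide; this vertex is its base point. -/
def Path.IsCycle {n : ℕ} (hn : 1 ≤ n) (μ : E.Path n) : Prop := μ.range hn = μ.source hn

/-- A cycle has an entrance if some edge `e` differs from an edge `μᵢ` of the cycle and has the same
range as `μᵢ`. -/
def Path.HasEntrance {n : ℕ} (μ : E.Path n) : Prop :=
  ∃ (i : Fin n) (e : Ed), E.r e = E.r (μ.1 i) ∧ e ≠ μ.1 i

theorem block_index_lt {k n j i : ℕ} (hj : j < k) (hi : i < n) : j * n + i < k * n :=
  calc j * n + i < j * n + n := Nat.add_lt_add_left hi _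
    _ = (j + 1) * n := (Nat.succ_mul j n).symm
    _ ≤ k * n := Nat.mul_le_mul_right n hj

/-- The `j`-th block of length `n` of a path of length `k * n`, with `j = 0, …, k - 1`. -/
def Path.block {k n : ℕ} (α : E.Path (k * n)) (j : Fin k) : E.Path n :=
  ⟨fun i => α.1 ⟨j * n + i, block_index_lt j.2 i.2⟩,
    fun i hi => α.2 (j * n + i) (block_index_lt j.2 hi)⟩

/-- `k N`: the paths `α` of length `k * n` with `α ∈ N × ⋯ × N` (`k` factors), that is,
the paths that are concatenations of `k` elements of `N`. -/
def blockPower (k : ℕ) {n : ℕ} (N : Set (E.Path n)) : Set (E.Path (k * n)) :=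
  {α | ∀ j : Fin k, α.block j ∈ N}

variable (E)

/-- `Bⁿ`: the cycles `μ` of length `n` for which there are `k ≥ 1` and an open neighbourhood `N`
of `μ` in `Eⁿ` such that no path in `N` connects `s(α)` to `s(β)` for distinct `α, β ∈ k N`, and
no cycle in `N` whose base point is `s(α)` for some `α ∈ k N` has an entrance. -/
def B {n : ℕ} (hn : 1 ≤ n) : Set (E.Path n) :=
  {μ | μ.IsCycle hn ∧ ∃ (k : ℕ) (hk : 1 ≤ k) (N : Set (E.Path n)), IsOpen N ∧ μ ∈ N ∧
    (∀ α ∈ blockPower k N, ∀ β ∈ blockPower k N, α ≠ β →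
      ¬ ∃ γ ∈ N, γ.range hn = α.source (Nat.mul_pos hk hn) ∧
        γ.source hn = β.source (Nat.mul_pos hk hn)) ∧
    (∀ α ∈ blockPower k N,
      ¬ ∃ γ ∈ N, γ.IsCycle hn ∧ γ.HasEntrance ∧ γ.range hn = α.source (Nat.mul_pos hk hn))}

/-! ### The boundary path groupoid -/

variable {E} in
/-- The one-sided shift `σ : x₁ x₂ x₃ ⋯ ↦ x₂ x₃ ⋯` on `E^∞`. -/
def shift (x : E.InfPath) : E.InfPath := ⟨fun i => x.1 (i + 1), fun i => x.2 (i + 1)⟩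

/-- The boundary path groupoid `Γ(E^∞, σ)`: the triples `(x, k - l, y)` in `E^∞ × ℤ × E^∞` with
`σᵏ(x) = σˡ(y)`. The range of `(x, m, y)` is `x` and its source is `y`; the unit space is
identified with `E^∞`. -/
structure BoundaryPathGroupoid where
  /-- the range `x` of `(x, m, y)` -/
  range : E.InfPath
  /-- the integer `m` of `(x, m, y)` -/
  degree : ℤ
  /-- the source `y` of `(x, m, y)` -/
  source : E.InfPath
  exists_shift : ∃ k l : ℕ, degree = (k : ℤ) - (l : ℤ) ∧ shift^[k] range = shift^[l] source

namespace BoundaryPathGroupoid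

variable {E}

/-- The set `𝒰(U, W, k, l)` of all `(x, k - l, y)` with `x ∈ U`, `y ∈ W` and `σᵏ(x) = σˡ(y)`. -/
def basicSet (U W : Set E.InfPath) (k l : ℕ) : Set E.BoundaryPathGroupoid :=
  {g | g.degree = (k : ℤ) - (l : ℤ) ∧ g.range ∈ U ∧ g.source ∈ W ∧
    shift^[k] g.range = shift^[l] g.source}

/-- The topology with open base the sets `𝒰(U, W, k, l)`, where `U` and `W` are open, `σᵏ` is
injective on `U` and `σˡ` is injective on `W`. -/
instance : TopologicalSpace E.BoundaryPathGroupoid :=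
  TopologicalSpace.generateFrom
    {S | ∃ (U W : Set E.InfPath) (k l : ℕ), IsOpen U ∧ IsOpen W ∧
      InjOn shift^[k] U ∧ InjOn shift^[l] W ∧ S = basicSet U W k l}

variable (E)

/-- The isotropy group bundle: the union over the units `u` of the isotropy groups
`Γ_u^u`, which consist of the elements with range and source equal to `u`. -/
def isotropyBundle : Set E.BoundaryPathGroupoid :=
  ⋃ u : E.InfPath, {g | g.range = u ∧ g.source = u}

end BoundaryPathGroupoid

end TopologicalGraph

/-!
Write `σ` for the shift on `E^∞`. Since no vertex is singular, `r` is surjective, so every finite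
path extends to an infinite one, and since `s` is a local homeomorphism, `σ` is continuous, open and
locally injective. Both sides of the equivalence are shown to say that, for every `n ≥ 1`, the
interior `Pₙ` of the set of points of `E^∞` fixed by `σⁿ` is closed.

* For the groupoid: near `(x, k - l, y)` the topology of the groupoid is the one induced from
  `E^∞ × E^∞` on the triples `(x', k - l, y')` with `σᵏ(x') = σˡ(y')`, for *any* admissible choice
  of `k` and `l` (`BoundaryPathGroupoid.nhds_eq`). Hence `(x, k - l, x)` is interior to the isotropy
  bundle if and only if `σᵏ = σˡ` near `x` (`isotropyBundle_mem_nhds_iff`). The locus where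
  `σˡ⁺ᵖ = σˡ` is the preimage of the fixed points of `σᵖ` under the open continuous map `σˡ`, so only
  the sets `Pₚ` matter (`isClosed_interior_isotropyBundle_iff`).

* For the paths: `Bⁿ` consists of the initial segments of length `n` of the elements of `Pₙ`
  (`B_eq_image_truncate`), and `μ ↦ μ^∞` identifies `Bⁿ` with `Pₙ` topologically. If `μ ∈ Bⁿ` with
  witnesses `k` and `N`, and the first `k + 1` blocks of `z` lie in `N`, then condition (1) applied
  to the paths formed by the first `k` and by the last `k` of these blocks makes these blocks equal,
  and condition (2) says that the resulting cycle has no entrance, so that `z` has no choice but to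
  repeat it. Conversely, if all `z` whose first `k` blocks lie in `N` are fixed by `σⁿ`, then for
  `α ∈ k N` there is exactly one infinite path `y` starting at `s(α)`, and `α y = y`; this gives
  (1) and (2).
-/

namespace TopologicalGraph

variable {V Ed : Type*}
  [TopologicalSpace V] [LocallyCompactSpace V] [T2Space V]
  [TopologicalSpace Ed] [LocallyCompactSpace Ed] [T2Space Ed]
  {E : TopologicalGraph V Ed}

/-! ### Extending paths -/

/-- Near any vertex `r` is proper, so its range is closed; it is dense as there are no sources. -/
theorem surjective_r (hE : E.singularVertices = ∅) : Function.Surjective E.r := by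
  intro v
  have hv : v ∈ E.regularVertices := by
    by_contra h
    exact (hE ▸ (h : v ∈ E.singularVertices) : v ∈ (∅ : Set V))
  obtain ⟨⟨N, hN, hvN, hK⟩, hsrc⟩ := hv
  have hcl : v ∈ closure (range E.r) := by
    by_contra h
    exact hsrc (subset_closure h)
  have hmem : v ∈ closure (E.r '' (E.r ⁻¹' closure N)) := by
    rw [mem_closure_iff] at hcl ⊢
    intro O hO hvO
    obtain ⟨_, ⟨hwO, hwN⟩, e, rfl⟩ := hcl (O ∩ N) (hO.inter hN) ⟨hvO, hvN⟩
    exact ⟨_, hwO, e, subset_closure hwN, rfl⟩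
  rw [(hK.image E.continuous_r).isClosed.closure_eq] at hmem
  obtain ⟨e, -, he⟩ := hmem
  exact ⟨e, he⟩

theorem exists_infPath (hr : Function.Surjective E.r) (v : V) :
    ∃ y : E.InfPath, E.r (y.1 0) = v := by
  choose e he using hr
  refine ⟨⟨fun i => e ((fun w => E.s (e w))^[i] v), fun i => ?_⟩, he v⟩
  rw [he, Function.iterate_succ_apply']

/-- The infinite path `α y`. The hypothesis says that `y` starts where `α` ends; it is void if `α`
is empty. -/
def append {m : ℕ} (α : E.Path m) (y : E.InfPath)
    (h : ∀ (i : ℕ) (hi : i + 1 = m), E.s (α.1 ⟨i, by omega⟩) = E.r (y.1 0)) : E.InfPath :=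
  ⟨fun i => if hi : i < m then α.1 ⟨i, hi⟩ else y.1 (i - m), fun i => by
    beta_reduce
    rcases lt_trichotomy (i + 1) m with hi | hi | hi
    · rw [dif_pos (by omega), dif_pos hi]
      exact α.2 i hi
    · rw [dif_pos (by omega), dif_neg (by omega), h i hi, hi, Nat.sub_self]
    · rw [dif_neg (by omega), dif_neg (by omega), y.2,
        show i + 1 - m = i - m + 1 by omega]⟩

theorem append_apply_of_lt {m : ℕ} {α : E.Path m} {y : E.InfPath} {h} {i : ℕ} (hi : i < m) :
    (append α y h).1 i = α.1 ⟨i, hi⟩ :=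
  dif_pos hi

theorem append_apply_add {m : ℕ} {α : E.Path m} {y : E.InfPath} {h} (i : ℕ) :
    (append α y h).1 (i + m) = y.1 i := by
  simp [append]

theorem Path.s_eq_source {m : ℕ} (hm : 1 ≤ m) (α : E.Path m) (i : ℕ) (hi : i + 1 = m) :
    E.s (α.1 ⟨i, by omega⟩) = α.source hm := by
  subst hi
  rfl

/-- The initial segment of length `m` of an infinite path. -/
def truncate (m : ℕ) (x : E.InfPath) : E.Path m :=
  ⟨fun i => x.1 i, fun i _ => x.2 i⟩

theorem continuous_truncate (m : ℕ) : Continuous (truncate m : E.InfPath → E.Path m) :=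
  continuous_induced_rng.2 (continuous_pi fun i =>
    (continuous_apply (i : ℕ)).comp continuous_subtype_val)

/-- The infinite path `μ^∞ = μ μ μ ⋯` of a cycle `μ`. -/
def Path.power {n : ℕ} (hn : 1 ≤ n) (μ : E.Path n) (hμ : μ.IsCycle hn) : E.InfPath :=
  ⟨fun i => μ.1 ⟨i % n, Nat.mod_lt _ hn⟩, fun i => by
    have hlt := Nat.mod_lt i hn
    by_cases hi : i % n + 1 < n
    · have h : (i + 1) % n = i % n + 1 := by
        rw [← Nat.mod_add_mod, Nat.mod_eq_of_lt hi]
      simpa only [h] using μ.2 (i % n) hi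
    · have h1 : i % n + 1 = n := by omega
      have h : (i + 1) % n = 0 := by
        rw [← Nat.mod_add_mod, h1, Nat.mod_self]
      simp only [h]
      rw [μ.s_eq_source hn _ h1]
      exact hμ.symm⟩

theorem truncate_power {n : ℕ} (hn : 1 ≤ n) (μ : E.Path n) (hμ : μ.IsCycle hn) :
    truncate n (μ.power hn hμ) = μ := by
  refine Subtype.ext (funext fun i => ?_)
  simp [truncate, Path.power, Nat.mod_eq_of_lt i.2]

/-- A cycle without an entrance leaves no choice to a path that starts at its base point. -/
theorem eq_power {n : ℕ} (hn : 1 ≤ n) (μ : E.Path n) (hμ : μ.IsCycle hn) (he : ¬ μ.HasEntrance)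
    (y : E.InfPath) (hy : E.r (y.1 0) = μ.range hn) : y = μ.power hn hμ := by
  have key : ∀ (i : Fin n) (e : Ed), E.r e = E.r (μ.1 i) → e = μ.1 i := fun i e h => by
    by_contra hne
    exact he ⟨i, e, h, hne⟩
  refine Subtype.ext (funext fun i => ?_)
  induction i with
  | zero =>
    refine key _ _ (hy.trans ?_)
    simp [Path.range]
  | succ i ih =>
    refine key _ _ ?_
    rw [← y.2 i, ih]
    exact (μ.power hn hμ).2 i

/-! ### The shift is continuous, open and locally injective -/

theorem shift_iterate_apply (k : ℕ) (x : E.InfPath) (i : ℕ) :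
    (shift^[k] x).1 i = x.1 (i + k) := by
  induction k generalizing x with
  | zero => rfl
  | succ k ih =>
    rw [Function.iterate_succ_apply, ih]
    rfl

theorem continuous_shift : Continuous (shift : E.InfPath → E.InfPath) :=
  continuous_induced_rng.2 (continuous_pi fun i =>
    (continuous_apply (i + 1)).comp continuous_subtype_val)

theorem continuous_shift_iterate (k : ℕ) : Continuous (shift^[k] : E.InfPath → E.InfPath) :=
  continuous_shift.iterate k

theorem isOpenMap_shift : IsOpenMap (shift : E.InfPath → E.InfPath) := by
  rw [isOpenMap_iff_nhds_le]
  intro x S hS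
  obtain ⟨e, hxe, hes⟩ := E.isLocalHomeomorph_s (x.1 0)
  obtain ⟨O, hO, hOS⟩ := (mem_nhds_subtype _ _ _).1 (Filter.mem_map.1 hS)
  -- A local section of the shift: put `e⁻¹(r(y))` in front of `y`.
  let G : E.InfPath → ℕ → Ed := fun y i => Nat.casesOn i (e.symm (E.r (y.1 0))) y.1
  have hx0 : E.r ((shift x).1 0) = e (x.1 0) := by
    rw [← hes]
    exact (x.2 0).symm
  have hcr : Continuous fun y : E.InfPath => E.r (y.1 0) :=
    E.continuous_r.comp ((continuous_apply 0).comp continuous_subtype_val)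
  have hG : ContinuousAt G (shift x) := by
    refine continuousAt_pi.2 fun i => ?_
    cases i with
    | zero =>
      refine ContinuousAt.comp (g := e.symm) ?_ hcr.continuousAt
      exact e.continuousAt_symm (by rw [hx0]; exact e.map_source hxe)
    | succ i => exact ((continuous_apply i).comp continuous_subtype_val).continuousAt
  have hGx : G (shift x) = x.1 := by
    funext i
    cases i with
    | zero => exact (congrArg e.symm hx0).trans (e.left_inv hxe)
    | succ i => rfl
  have h1 : ∀ᶠ y in 𝓝 (shift x), G y ∈ O := hG (by rwa [hGx])
  have h2 : ∀ᶠ y in 𝓝 (shift x), E.r (y.1 0) ∈ e.target :=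
    hcr.continuousAt (e.open_target.mem_nhds (by rw [hx0]; exact e.map_source hxe))
  filter_upwards [h1, h2] with y hy1 hy2
  have hpath : ∀ i, E.s (G y i) = E.r (G y (i + 1)) := by
    intro i
    cases i with
    | zero =>
      rw [hes]
      exact e.right_inv hy2
    | succ i => exact y.2 i
  exact hOS (show (⟨G y, hpath⟩ : E.InfPath) ∈ Subtype.val ⁻¹' O from hy1)

theorem isOpenMap_shift_iterate (k : ℕ) : IsOpenMap (shift^[k] : E.InfPath → E.InfPath) := by
  induction k with
  | zero => exact IsOpenMap.id
  | succ k ih => exact ih.comp isOpenMap_shift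

theorem exists_mem_nhds_injOn_shift (x : E.InfPath) : ∃ U ∈ 𝓝 x, InjOn shift U := by
  obtain ⟨e, hxe, hes⟩ := E.isLocalHomeomorph_s (x.1 0)
  refine ⟨(fun y : E.InfPath => y.1 0) ⁻¹' e.source,
    ((continuous_apply 0).comp continuous_subtype_val).continuousAt
      (e.open_source.mem_nhds hxe), fun y hy z hz h => ?_⟩
  have hsucc : ∀ i, y.1 (i + 1) = z.1 (i + 1) := fun i => congrFun (congrArg Subtype.val h) i
  refine Subtype.ext (funext fun i => ?_)
  cases i with
  | zero =>
    refine e.injOn hy hz ?_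
    rw [← hes, y.2 0, z.2 0, hsucc 0]
  | succ i => exact hsucc i

theorem exists_isOpen_injOn_shift_iterate (k : ℕ) (x : E.InfPath) :
    ∃ U, IsOpen U ∧ x ∈ U ∧ InjOn shift^[k] U := by
  suffices h : ∃ U ∈ 𝓝 x, InjOn shift^[k] U by
    obtain ⟨U, hU, hinj⟩ := h
    obtain ⟨O, hOU, hO, hx⟩ := mem_nhds_iff.1 hU
    exact ⟨O, hO, hx, hinj.mono hOU⟩
  induction k generalizing x with
  | zero => exact ⟨univ, Filter.univ_mem, fun _ _ _ _ h => h⟩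
  | succ k ih =>
    obtain ⟨U, hU, hUinj⟩ := exists_mem_nhds_injOn_shift x
    obtain ⟨W, hW, hWinj⟩ := ih (shift x)
    refine ⟨U ∩ shift ⁻¹' W, Filter.inter_mem hU (continuous_shift.continuousAt hW),
      fun y hy z hz h => hUinj hy.1 hz.1 (hWinj hy.2 hz.2 h)⟩

/-! ### Coincidence of two iterates of the shift -/

variable (E) in
/-- The set of infinite paths `x` with `σᵏ(x) = σˡ(x)`. For `l = 0` these are the fixed points
of `σᵏ`. -/
def shiftCoincidence (k l : ℕ) : Set E.InfPath := {x | shift^[k] x = shift^[l] x}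

theorem mem_shiftCoincidence_zero_iff {n : ℕ} {x : E.InfPath} :
    x ∈ E.shiftCoincidence n 0 ↔ Function.Periodic x.1 n := by
  refine Subtype.ext_iff.trans (funext_iff.trans (forall_congr' fun i => ?_))
  rw [shift_iterate_apply]
  rfl

theorem isClosed_shiftCoincidence (k l : ℕ) : IsClosed (E.shiftCoincidence k l) :=
  isClosed_eq (continuous_shift_iterate k) (continuous_shift_iterate l)

theorem isClosed_interior_shiftCoincidence
    (h : ∀ n : ℕ, 1 ≤ n → IsClosed (interior (E.shiftCoincidence n 0))) (k l : ℕ) :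
    IsClosed (interior (E.shiftCoincidence k l)) := by
  have key : ∀ n l : ℕ, 1 ≤ n → IsClosed (interior (E.shiftCoincidence (n + l) l)) := by
    intro n l hn
    have heq : E.shiftCoincidence (n + l) l = shift^[l] ⁻¹' E.shiftCoincidence n 0 := by
      ext x
      simp only [shiftCoincidence, mem_ofPred_eq, mem_preimage, Function.iterate_add_apply,
        Function.iterate_zero, id]
    rw [heq, ← (isOpenMap_shift_iterate l).preimage_interior_eq_interior_preimage
      (continuous_shift_iterate l)]
    exact (h n hn).preimage (continuous_shift_iterate l)
  rcases lt_trichotomy k l with hkl | rfl | hkl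
  · have hsymm : E.shiftCoincidence k l = E.shiftCoincidence l k := by
      ext x
      exact eq_comm
    rw [hsymm]
    simpa [Nat.sub_add_cancel hkl.le] using key (l - k) k (by omega)
  · have huniv : E.shiftCoincidence k k = univ := eq_univ_of_forall fun x => rfl
    rw [huniv, interior_univ]
    exact isClosed_univ
  · simpa [Nat.sub_add_cancel hkl.le] using key (k - l) l (by omega)

/-! ### The interior of the isotropy bundle -/

namespace BoundaryPathGroupoid

theorem mem_isotropyBundle {g : E.BoundaryPathGroupoid} :
    g ∈ isotropyBundle E ↔ g.range = g.source := by
  simp [isotropyBundle, eq_comm]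

/-- The representation of the degree as `k - l` need not be the one with the least `k` and `l`: as
the shift is locally injective, all of them give the same neighbourhoods. -/
theorem nhds_eq (g : E.BoundaryPathGroupoid) {k l : ℕ} (hd : g.degree = (k : ℤ) - l)
    (hs : shift^[k] g.range = shift^[l] g.source) :
    𝓝 g = Filter.comap (fun h => (h.range, h.source)) (𝓝 (g.range, g.source)) ⊓
      Filter.principal {h | h.degree = (k : ℤ) - l ∧ shift^[k] h.range = shift^[l] h.source} := by
  apply le_antisymm
  · obtain ⟨U₀, hU₀, hgU₀, hiU₀⟩ := exists_isOpen_injOn_shift_iterate k g.range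
    obtain ⟨W₀, hW₀, hgW₀, hiW₀⟩ := exists_isOpen_injOn_shift_iterate l g.source
    have hbasic : ∀ U W : Set E.InfPath, IsOpen U → IsOpen W → g.range ∈ U → g.source ∈ W →
        basicSet (U ∩ U₀) (W ∩ W₀) k l ∈ 𝓝 g := by
      intro U W hU hW hgU hgW
      have hopen : IsOpen (basicSet (U ∩ U₀) (W ∩ W₀) k l) :=
        TopologicalSpace.isOpen_generateFrom_of_mem
          ⟨U ∩ U₀, W ∩ W₀, k, l, hU.inter hU₀, hW.inter hW₀, hiU₀.mono inter_subset_right,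
            hiW₀.mono inter_subset_right, rfl⟩
      exact hopen.mem_nhds ⟨hd, ⟨hgU, hgU₀⟩, ⟨hgW, hgW₀⟩, hs⟩
    refine le_inf ?_ ?_
    · rw [← Filter.tendsto_iff_comap, nhds_prod_eq]
      refine Filter.Tendsto.prodMk ?_ ?_
      · intro S hS
        obtain ⟨U, hUS, hU, hgU⟩ := mem_nhds_iff.1 hS
        exact Filter.mem_map.2 <| Filter.mem_of_superset (hbasic U univ hU isOpen_univ hgU (mem_univ _))
          fun h (hh : h ∈ basicSet _ _ k l) => hUS hh.2.1.1
      · intro S hS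
        obtain ⟨W, hWS, hW, hgW⟩ := mem_nhds_iff.1 hS
        exact Filter.mem_map.2 <| Filter.mem_of_superset (hbasic univ W isOpen_univ hW (mem_univ _) hgW)
          fun h (hh : h ∈ basicSet _ _ k l) => hWS hh.2.2.1.1
    · rw [Filter.le_principal_iff]
      exact Filter.mem_of_superset
        (hbasic univ univ isOpen_univ isOpen_univ (mem_univ _) (mem_univ _))
        fun h hh => ⟨hh.1, hh.2.2.2⟩
  · refine le_of_le_of_eq (le_iInf₂ fun S hS => ?_) TopologicalSpace.nhds_generateFrom.symm
    obtain ⟨hgS, U, W, k', l', hU, hW, -, -, rfl⟩ := hS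
    obtain ⟨hd', hgU, hgW, hs'⟩ := hgS
    rw [Filter.le_principal_iff]
    have hUW : (fun h : E.BoundaryPathGroupoid => (h.range, h.source)) ⁻¹' (U ×ˢ W) ∈
        Filter.comap (fun h : E.BoundaryPathGroupoid => (h.range, h.source))
          (𝓝 (g.range, g.source)) :=
      Filter.preimage_mem_comap (prod_mem_nhds (hU.mem_nhds hgU) (hW.mem_nhds hgW))
    rcases le_total k k' with hk | hk
    · -- Here `k' = k + j` and `l' = l + j`, so `σᵏ(x) = σˡ(y)` implies `σᵏ'(x) = σˡ'(y)`.
      refine Filter.mem_of_superset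
        (Filter.inter_mem_inf hUW (Filter.mem_principal_self _)) ?_
      rintro h ⟨⟨hhU, hhW⟩, hhd, hhs⟩
      refine ⟨by omega, hhU, hhW, ?_⟩
      rw [show k' = (k' - k) + k by omega, show l' = (k' - k) + l by omega,
        Function.iterate_add_apply, Function.iterate_add_apply, hhs]
    · -- Here `k = k' + j` and `l = l' + j`, and `σʲ` is injective near `σᵏ'(x) = σˡ'(y)`.
      obtain ⟨O, hO, hgO, hinj⟩ :=
        exists_isOpen_injOn_shift_iterate (k - k') (shift^[k'] g.range)
      have hOO : (fun h : E.BoundaryPathGroupoid => (h.range, h.source)) ⁻¹'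
          ((shift^[k'] ⁻¹' O) ×ˢ (shift^[l'] ⁻¹' O)) ∈
          Filter.comap (fun h : E.BoundaryPathGroupoid => (h.range, h.source))
            (𝓝 (g.range, g.source)) :=
        Filter.preimage_mem_comap (prod_mem_nhds
          ((continuous_shift_iterate k').continuousAt (hO.mem_nhds hgO))
          ((continuous_shift_iterate l').continuousAt (hO.mem_nhds (hs' ▸ hgO))))
      refine Filter.mem_of_superset (Filter.inter_mem_inf (Filter.inter_mem hUW hOO)
        (Filter.mem_principal_self _)) ?_
      rintro h ⟨⟨⟨hhU, hhW⟩, hhO1, hhO2⟩, hhd, hhs⟩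
      refine ⟨by omega, hhU, hhW, hinj hhO1 hhO2 ?_⟩
      rw [← Function.iterate_add_apply, ← Function.iterate_add_apply,
        show k - k' + k' = k by omega, show k - k' + l' = l by omega, hhs]

theorem continuous_range : Continuous (range : E.BoundaryPathGroupoid → E.InfPath) := by
  refine continuous_iff_continuousAt.2 fun g => ?_
  obtain ⟨k, l, hd, hs⟩ := g.exists_shift
  rw [ContinuousAt, nhds_eq g hd hs]
  exact (continuous_fst.tendsto _).comp (Filter.tendsto_comap.mono_left inf_le_left)

theorem continuous_source : Continuous (source : E.BoundaryPathGroupoid → E.InfPath) := by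
  refine continuous_iff_continuousAt.2 fun g => ?_
  obtain ⟨k, l, hd, hs⟩ := g.exists_shift
  rw [ContinuousAt, nhds_eq g hd hs]
  exact (continuous_snd.tendsto _).comp (Filter.tendsto_comap.mono_left inf_le_left)

theorem isClosed_isotropyBundle : IsClosed (isotropyBundle E) := by
  have h : isotropyBundle E = {g | g.range = g.source} := ext fun g => mem_isotropyBundle
  rw [h]
  exact isClosed_eq continuous_range continuous_source

/-- An element `(x, k - l, x)` is interior to the isotropy bundle if and only if `σᵏ = σˡ`
near `x`. -/
theorem isotropyBundle_mem_nhds_iff (g : E.BoundaryPathGroupoid) {k l : ℕ}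
    (hd : g.degree = (k : ℤ) - l) (hs : shift^[k] g.range = shift^[l] g.source)
    (hg : g.range = g.source) :
    isotropyBundle E ∈ 𝓝 g ↔ E.shiftCoincidence k l ∈ 𝓝 g.range := by
  rw [nhds_eq g hd hs, Filter.mem_inf_principal, Filter.mem_comap, ← hg, nhds_prod_eq]
  constructor
  · rintro ⟨T, hT, hTsub⟩
    obtain ⟨U, hU, hUT⟩ := Filter.mem_prod_same_iff.1 hT
    -- As `σˡ` is open, every `y` near `x` has some `z` near `x` with `σᵏ(y) = σˡ(z)`.
    have himg : shift^[l] '' U ∈ 𝓝 (shift^[k] g.range) := by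
      rw [hs, ← hg]
      exact (isOpenMap_shift_iterate l).image_mem_nhds hU
    filter_upwards [hU, (continuous_shift_iterate k).continuousAt himg] with y hy hy'
    obtain ⟨z, hz, hzy⟩ := hy'
    have hyz : y = z := mem_isotropyBundle.1
      (hTsub (a := ⟨y, (k : ℤ) - l, z, k, l, rfl, hzy.symm⟩) (hUT ⟨hy, hz⟩) ⟨rfl, hzy.symm⟩)
    exact hzy.symm.trans (by rw [hyz])
  · intro h
    obtain ⟨U, hU, hgU, hinj⟩ := exists_isOpen_injOn_shift_iterate k g.range
    refine ⟨_, Filter.prod_mem_prod (hU.mem_nhds hgU)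
      (Filter.inter_mem (hU.mem_nhds hgU) h), ?_⟩
    rintro a ⟨ha1, ha2, ha3⟩ ⟨-, has⟩
    exact mem_isotropyBundle.2 (hinj ha1 ha2 (has.trans ha3.symm))

theorem isClosed_interior_isotropyBundle_iff :
    IsClosed (interior (isotropyBundle E)) ↔
      ∀ n : ℕ, 1 ≤ n → IsClosed (interior (E.shiftCoincidence n 0)) := by
  constructor
  · intro h n _
    -- The map `x ↦ (x, n, x)` is continuous on the set of fixed points of `σⁿ`.
    let ι : E.shiftCoincidence n 0 → E.BoundaryPathGroupoid :=
      fun x => ⟨x, (n : ℤ) - (0 : ℕ), x, n, 0, rfl, x.2⟩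
    have hι : Continuous ι := by
      refine continuous_iff_continuousAt.2 fun x => ?_
      rw [ContinuousAt, nhds_eq (ι x) rfl x.2, Filter.tendsto_inf, Filter.tendsto_principal]
      exact ⟨Filter.tendsto_comap_iff.2
        ((continuous_subtype_val.prodMk continuous_subtype_val).tendsto x),
        Filter.Eventually.of_forall fun y => ⟨rfl, y.2⟩⟩
    have heq : interior (E.shiftCoincidence n 0) =
        Subtype.val '' (ι ⁻¹' interior (isotropyBundle E)) := by
      ext x
      simp only [mem_image, mem_preimage, mem_interior_iff_mem_nhds]
      constructor
      · intro hx
        have hxn : x ∈ E.shiftCoincidence n 0 := mem_of_mem_nhds hx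
        exact ⟨⟨x, hxn⟩, (isotropyBundle_mem_nhds_iff (ι ⟨x, hxn⟩) rfl hxn rfl).2 hx, rfl⟩
      · rintro ⟨x, hx, rfl⟩
        exact (isotropyBundle_mem_nhds_iff (ι x) rfl x.2 rfl).1 hx
    rw [heq]
    exact (isClosed_shiftCoincidence n 0).isClosedEmbedding_subtypeVal.isClosedMap _
      (h.preimage hι)
  · intro h
    refine isClosed_of_closure_subset fun g hg => ?_
    have hgI : g.range = g.source := mem_isotropyBundle.1
      (closure_minimal interior_subset isClosed_isotropyBundle hg)
    obtain ⟨k, l, hd, hs⟩ := g.exists_shift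
    rw [mem_interior_iff_mem_nhds, isotropyBundle_mem_nhds_iff g hd hs hgI,
      ← mem_interior_iff_mem_nhds, ← (isClosed_interior_shiftCoincidence h k l).closure_eq]
    refine mem_closure_iff_nhds.2 fun U hU => ?_
    have hnhds : range ⁻¹' U ∩
        {a : E.BoundaryPathGroupoid |
          a.degree = (k : ℤ) - l ∧ shift^[k] a.range = shift^[l] a.source} ∈ 𝓝 g := by
      refine Filter.inter_mem (continuous_range.continuousAt hU) ?_
      rw [nhds_eq g hd hs]
      exact Filter.mem_inf_of_right (Filter.mem_principal_self _)
    obtain ⟨a, ⟨haU, had, has⟩, haI⟩ := mem_closure_iff_nhds.1 hg _ hnhds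
    exact ⟨a.range, haU, mem_interior_iff_mem_nhds.2 ((isotropyBundle_mem_nhds_iff a had has
      (mem_isotropyBundle.1 (interior_subset haI))).1 (mem_interior_iff_mem_nhds.1 haI))⟩

end BoundaryPathGroupoid

/-! ### The cycles in `Bⁿ` -/

theorem isCycle_truncate {n : ℕ} (hn : 1 ≤ n) {x : E.InfPath}
    (hx : x ∈ E.shiftCoincidence n 0) : (truncate n x).IsCycle hn := by
  have h := mem_shiftCoincidence_zero_iff.1 hx 0
  rw [Path.IsCycle, ← Path.s_eq_source hn _ (n - 1) (by omega)]
  change E.r (x.1 0) = E.s (x.1 (n - 1))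
  rw [x.2, Nat.sub_add_cancel hn, ← h, zero_add]

theorem power_mem_shiftCoincidence {n : ℕ} (hn : 1 ≤ n) (μ : E.Path n) (hμ : μ.IsCycle hn) :
    μ.power hn hμ ∈ E.shiftCoincidence n 0 := by
  refine mem_shiftCoincidence_zero_iff.2 fun i => ?_
  simp [Path.power]

theorem eq_of_truncate_eq {n m : ℕ} (hn : 1 ≤ n) (hnm : n ≤ m) {x y : E.InfPath}
    (hx : x ∈ E.shiftCoincidence n 0) (hy : y ∈ E.shiftCoincidence n 0)
    (h : truncate m x = truncate m y) : x = y := by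
  refine Subtype.ext (funext fun i => ?_)
  rw [← (mem_shiftCoincidence_zero_iff.1 hx).map_mod_nat i,
    ← (mem_shiftCoincidence_zero_iff.1 hy).map_mod_nat i]
  exact congrFun (congrArg Subtype.val h) ⟨i % n, (Nat.mod_lt _ hn).trans_le hnm⟩

/-- The sets of paths whose first `k` blocks of length `n` lie in a neighbourhood `N` of `x₁ ⋯ xₙ`
form a neighbourhood base at a fixed point `x` of `σⁿ`. -/
theorem exists_blocks_subset {n : ℕ} (hn : 1 ≤ n) {x : E.InfPath}
    (hx : x ∈ E.shiftCoincidence n 0) {S : Set E.InfPath} (hS : S ∈ 𝓝 x) :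
    ∃ k : ℕ, 1 ≤ k ∧ ∃ N : Set (E.Path n), IsOpen N ∧ truncate n x ∈ N ∧
      ∀ z : E.InfPath, (∀ j < k, truncate n (shift^[j * n] z) ∈ N) → z ∈ S := by
  obtain ⟨T, hT, hTS⟩ := mem_nhds_subtype _ _ _ |>.1 hS
  obtain ⟨O, hOT, hO, hxO⟩ := mem_nhds_iff.1 hT
  obtain ⟨I, u, hu, hIu⟩ := isOpen_pi_iff.1 hO _ hxO
  refine ⟨I.sup id + 1, by omega,
    ⋂ i ∈ I, (fun ν : E.Path n => ν.1 ⟨i % n, Nat.mod_lt _ hn⟩) ⁻¹' u i,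
    isOpen_biInter_finset fun i hi => (hu i hi).1.preimage
      ((continuous_apply _).comp continuous_subtype_val), ?_, ?_⟩
  · simp only [mem_iInter]
    intro i hi
    change x.1 (i % n) ∈ u i
    rw [(mem_shiftCoincidence_zero_iff.1 hx).map_mod_nat]
    exact (hu i hi).2
  · intro z hz
    refine hTS (hOT (hIu fun i hi => ?_))
    have hik : i / n < I.sup id + 1 :=
      (Nat.div_le_self i n).trans_lt (Nat.lt_succ_of_le (Finset.le_sup (f := id) hi))
    have h := mem_iInter₂.1 (hz _ hik) i hi
    change (shift^[i / n * n] z).1 (i % n) ∈ u i at h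
    rwa [shift_iterate_apply, Nat.mod_add_div'] at h

theorem block_truncate {k n : ℕ} (z : E.InfPath) (j : Fin k) :
    (truncate (k * n) z).block j = truncate n (shift^[j * n] z) := by
  refine Subtype.ext (funext fun i => ?_)
  change z.1 (j * n + i) = (shift^[j * n] z).1 i
  rw [shift_iterate_apply, add_comm]

/-- If the first `k + 1` blocks of `z` lie in `N`, then condition (1) makes them equal, and
condition (2) forces `z` to repeat them. -/
theorem power_mem_interior_of_mem_B {n : ℕ} (hn : 1 ≤ n) {μ : E.Path n} (hμ : μ ∈ E.B hn) :
    μ.power hn hμ.1 ∈ interior (E.shiftCoincidence n 0) := by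
  obtain ⟨hcyc, k, hk, N, hN, hμN, h1, h2⟩ := hμ
  have hkn : 1 ≤ k * n := Nat.mul_pos hk hn
  refine mem_interior.2 ⟨⋂ j ∈ Finset.range (k + 1),
    (fun z : E.InfPath => truncate n (shift^[j * n] z)) ⁻¹' N, ?_, ?_, ?_⟩
  · intro z hz
    have hzN : ∀ j ≤ k, truncate n (shift^[j * n] z) ∈ N := fun j hj =>
      mem_iInter₂.1 hz j (Finset.mem_range.2 (by omega))
    have hα : truncate (k * n) z ∈ blockPower k N := fun j => by
      rw [block_truncate]
      exact hzN j j.2.le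
    have hβ : truncate (k * n) (shift^[n] z) ∈ blockPower k N := fun j => by
      rw [block_truncate, ← Function.iterate_add_apply, ← Nat.succ_mul]
      exact hzN _ j.2
    have hγ : truncate n (shift^[k * n] z) ∈ N := hzN k le_rfl
    have hr : (truncate n (shift^[k * n] z)).range hn = (truncate (k * n) z).source hkn := by
      change E.r ((shift^[k * n] z).1 0) = E.s (z.1 (k * n - 1))
      rw [shift_iterate_apply, z.2, Nat.sub_add_cancel hkn, zero_add]
    have hs : (truncate n (shift^[k * n] z)).source hn =
        (truncate (k * n) (shift^[n] z)).source hkn := by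
      change E.s ((shift^[k * n] z).1 (n - 1)) = E.s ((shift^[n] z).1 (k * n - 1))
      rw [shift_iterate_apply, shift_iterate_apply, show n - 1 + k * n = k * n - 1 + n by omega]
    have hαβ : truncate (k * n) z = truncate (k * n) (shift^[n] z) := by
      by_contra hne
      exact h1 _ hα _ hβ hne ⟨_, hγ, hr, hs⟩
    have hγc : (truncate n (shift^[k * n] z)).IsCycle hn := by
      rw [Path.IsCycle, hr, hs, hαβ]
    have hγe : ¬ (truncate n (shift^[k * n] z)).HasEntrance := fun he =>
      h2 _ hα ⟨_, hγ, hγc, he, hr⟩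
    have htail := eq_power hn _ hγc hγe (shift^[k * n] z) rfl
    have hper : Function.Periodic (shift^[k * n] z).1 n := mem_shiftCoincidence_zero_iff.1
      (htail ▸ power_mem_shiftCoincidence hn _ hγc)
    refine mem_shiftCoincidence_zero_iff.2 fun i => ?_
    rcases lt_or_ge i (k * n) with hi | hi
    · have h := congrFun (congrArg Subtype.val hαβ) ⟨i, hi⟩
      change z.1 i = (shift^[n] z).1 i at h
      rw [h, shift_iterate_apply]
    · have h := hper (i - k * n)
      rw [shift_iterate_apply, shift_iterate_apply] at h
      rwa [show i - k * n + n + k * n = i + n by omega, Nat.sub_add_cancel hi] at h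
  · exact isOpen_biInter_finset fun j _ =>
      hN.preimage ((continuous_truncate n).comp (continuous_shift_iterate _))
  · refine mem_iInter₂.2 fun j _ => ?_
    have hfix : shift^[j * n] (μ.power hn hcyc) = μ.power hn hcyc := by
      rw [mul_comm, Function.iterate_mul]
      exact Function.iterate_fixed (power_mem_shiftCoincidence hn μ hcyc) j
    rw [mem_preimage, hfix, truncate_power]
    exact hμN

/-- If `σⁿ` fixes all paths whose first `k` blocks lie in `N`, then for `α ∈ k N` every infinite
path `y` starting at `s(α)` equals `α y`, and so does not depend on choices. -/
theorem truncate_mem_B (hr : Function.Surjective E.r) {n : ℕ} (hn : 1 ≤ n) {x : E.InfPath}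
    (hx : x ∈ interior (E.shiftCoincidence n 0)) : truncate n x ∈ E.B hn := by
  have hxfix : x ∈ E.shiftCoincidence n 0 := interior_subset hx
  obtain ⟨k, hk, N, hN, hxN, hNS⟩ :=
    exists_blocks_subset hn hxfix (mem_interior_iff_mem_nhds.1 hx)
  have hkn : 1 ≤ k * n := Nat.mul_pos hk hn
  have hnkn : n ≤ k * n := Nat.le_mul_of_pos_left n hk
  have key : ∀ α ∈ blockPower k N, ∀ y : E.InfPath, E.r (y.1 0) = α.source hkn →
      y ∈ E.shiftCoincidence n 0 ∧ truncate (k * n) y = α := by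
    intro α hα y hy
    have hαy := fun i hi => (α.s_eq_source hkn i hi).trans hy.symm
    let z := append α y hαy
    have hzα : truncate (k * n) z = α := Subtype.ext (funext fun i => append_apply_of_lt (h := hαy) i.2)
    have hzfix : z ∈ E.shiftCoincidence n 0 := hNS z fun j hj => by
      rw [← block_truncate z ⟨j, hj⟩, hzα]
      exact hα ⟨j, hj⟩
    have hzy : z = y := by
      have h : shift^[k * n] z = z := by
        rw [mul_comm, Function.iterate_mul]
        exact Function.iterate_fixed hzfix k
      rw [← h]
      refine Subtype.ext (funext fun i => ?_)
      rw [shift_iterate_apply]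
      exact append_apply_add i
    rw [← hzy]
    exact ⟨hzfix, hzα⟩
  have huniq : ∀ α ∈ blockPower k N, ∀ y y' : E.InfPath, E.r (y.1 0) = α.source hkn →
      E.r (y'.1 0) = α.source hkn → y = y' := fun α hα y y' hy hy' =>
    eq_of_truncate_eq hn hnkn (key α hα y hy).1 (key α hα y' hy').1
      ((key α hα y hy).2.trans (key α hα y' hy').2.symm)
  refine ⟨isCycle_truncate hn hxfix, k, hk, N, hN, hxN, ?_, ?_⟩
  · rintro α hα β hβ hne ⟨γ, -, hγr, hγs⟩
    obtain ⟨y, hy⟩ := exists_infPath hr (β.source hkn)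
    -- The path `γ y` starts at `s(α)`, so it is fixed by `σⁿ`; hence `γ y = y`.
    let w := append γ y fun i hi => (γ.s_eq_source hn i hi).trans (hγs.trans hy.symm)
    have hw0 : E.r (w.1 0) = α.source hkn := by
      rw [← hγr]
      exact congrArg E.r (append_apply_of_lt hn)
    have hwy : w = y := by
      have h : shift^[n] w = w := (key α hα w hw0).1
      rw [← h]
      refine Subtype.ext (funext fun i => ?_)
      rw [shift_iterate_apply]
      exact append_apply_add i
    exact hne ((key α hα w hw0).2.symm.trans (hwy ▸ (key β hβ y hy).2))
  · rintro α hα ⟨γ, -, hγc, ⟨i, e, her, hne⟩, hγr⟩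
    obtain ⟨y, hy⟩ := exists_infPath hr (E.s e)
    -- Leave the cycle `γ` by the edge `e` in place of its `i`-th edge.
    let u : E.InfPath := append (m := 1) ⟨fun _ => e, fun j hj => by omega⟩ y fun _ _ => hy.symm
    let p := γ.power hn hγc
    have hpi : p.1 i = γ.1 i := congrFun (congrArg Subtype.val (truncate_power hn γ hγc)) i
    let w := append (truncate i p) u fun j hj => by
      change E.s (p.1 j) = E.r e
      rw [p.2 j, hj, hpi, her]
    have hwi : w.1 i = e := by
      have h : w.1 (0 + i) = u.1 0 := append_apply_add 0
      rwa [zero_add] at h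
    have hp0 : E.r (p.1 0) = α.source hkn := by
      rw [← hγr]
      exact congrArg E.r (congrFun (congrArg Subtype.val (truncate_power hn γ hγc)) ⟨0, hn⟩)
    have hw0 : E.r (w.1 0) = α.source hkn := by
      rw [← hp0]
      rcases Nat.eq_zero_or_pos (i : ℕ) with hi | hi
      · rw [hi] at hwi hpi
        rw [hwi, hpi, her]
      · exact congrArg E.r (append_apply_of_lt hi)
    refine hne ?_
    rw [← hwi, ← hpi, huniq α hα w p hw0 hp0]

theorem B_eq_image_truncate (hr : Function.Surjective E.r) {n : ℕ} (hn : 1 ≤ n) :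
    E.B hn = truncate n '' interior (E.shiftCoincidence n 0) := by
  ext μ
  constructor
  · intro hμ
    exact ⟨_, power_mem_interior_of_mem_B hn hμ, truncate_power hn μ hμ.1⟩
  · rintro ⟨x, hx, rfl⟩
    exact truncate_mem_B hr hn hx

theorem isClosed_B_iff (hr : Function.Surjective E.r) {n : ℕ} (hn : 1 ≤ n) :
    IsClosed (E.B hn) ↔ IsClosed (interior (E.shiftCoincidence n 0)) := by
  rw [B_eq_image_truncate hr hn]
  constructor
  · intro h
    have heq : interior (E.shiftCoincidence n 0) = E.shiftCoincidence n 0 ∩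
        truncate n ⁻¹' (truncate n '' interior (E.shiftCoincidence n 0)) := by
      refine Subset.antisymm
        (fun x hx => ⟨interior_subset hx, mem_image_of_mem _ hx⟩) ?_
      rintro x ⟨hx, y, hy, hyx⟩
      rwa [← eq_of_truncate_eq hn le_rfl (interior_subset hy) hx hyx]
    rw [heq]
    exact (isClosed_shiftCoincidence n 0).inter (h.preimage (continuous_truncate n))
  · intro h
    have hcl : IsClosed {x : ℕ → Ed | ∀ i, E.s (x i) = E.r (x (i + 1))} := by
      rw [ofPred_forall]
      exact isClosed_iInter fun i => isClosed_eq
        (E.isLocalHomeomorph_s.continuous.comp (continuous_apply i))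
        (E.continuous_r.comp (continuous_apply (i + 1)))
    -- `μ ↦ μ μ μ ⋯` is continuous as a map into all sequences of edges, in which `E^∞` is closed.
    have heq : truncate n '' interior (E.shiftCoincidence n 0) =
        (fun (μ : E.Path n) (i : ℕ) => μ.1 ⟨i % n, Nat.mod_lt _ hn⟩) ⁻¹'
          (Subtype.val '' interior (E.shiftCoincidence n 0)) := by
      ext μ
      constructor
      · rintro ⟨x, hx, rfl⟩
        refine ⟨x, hx, funext fun i => ?_⟩
        exact ((mem_shiftCoincidence_zero_iff.1 (interior_subset hx)).map_mod_nat i).symm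
      · rintro ⟨x, hx, hxμ⟩
        refine ⟨x, hx, Subtype.ext (funext fun i => ?_)⟩
        refine (congrFun hxμ i).trans ?_
        simp [Nat.mod_eq_of_lt i.2]
    rw [heq]
    exact (hcl.isClosedEmbedding_subtypeVal.isClosedMap _ h).preimage
      (continuous_pi fun i => (continuous_apply _).comp continuous_subtype_val)

end TopologicalGraph

theorem theorem3p5 {V Ed : Type*}
    [TopologicalSpace V] [LocallyCompactSpace V] [T2Space V] [SecondCountableTopology V]
    [TopologicalSpace Ed] [LocallyCompactSpace Ed] [T2Space Ed] [SecondCountableTopology Ed]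
    (E : TopologicalGraph V Ed) (hE : E.singularVertices = ∅) :
    IsClosed (interior (TopologicalGraph.BoundaryPathGroupoid.isotropyBundle E)) ↔
      ∀ (n : ℕ) (hn : 1 ≤ n), IsClosed (E.B hn) := by
  rw [TopologicalGraph.BoundaryPathGroupoid.isClosed_interior_isotropyBundle_iff]
  exact forall₂_congr fun n hn =>
    (TopologicalGraph.isClosed_B_iff (TopologicalGraph.surjective_r hE) hn).symm
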